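/- Let $n,m\ge 1$ and let $\mathbf{x}_1,\dots,\mathbf{x}_m\in\mathbb{R}_{>0}^n$, $\mathbf{x}_l=(x_l^{(1)},\dots,x_l^{(n)})$; all upper indices (and the index $r$ of $\kappa_r$) are read modulo $n$. **The action.** For $\mathbf a,\mathbf b\in\mathbb{R}_{>0}^n$ put $$\kappa_r(\mathbf a,\mathbf b)=\sum_{s=0}^{n-1}\ \prod_{t=r+1}^{r+s}b^{(t)}\prod_{t=r+s+1}^{r+n-1}a^{(t)},$$ and let $\eta(\mathbf a,\mathbf b)=(\mathbf b',\mathbf a')$ with $$b'^{(r)}=\frac{b^{(r+1)}\kappa_{r+1}(\mathbf a,\mathbf b)}{\kappa_r(\mathbf a,\mathbf b)},\qquad a'^{(r)}=\frac{a^{(r-1)}\kappa_{r-1}(\mathbf a,\mathbf b)}{\kappa_r(\mathbf a,\mathbf b)}.$$ For $1\le p<m$ the simple transposition $s_p$ acts on $m$-tuples of vectors by replacing $(\mathbf x_p,\mathbf x_{p+1})$ by $\eta(\mathbf x_p,\mathbf x_{p+1})$ and fixing the other entries; a product of simple transpositions acts by composition, the rightmost factor first. For such a product $s$ write $s(\mathbf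 x_1,\dots,\mathbf x_m)=(s(\mathbf x_1),\dots,s(\mathbf x_m))$ and let $s(x_l^{(r)})$ be the $r$-th coordinate of $s(\mathbf x_l)$. **The functions.** For $q\ge 0$ and a (possibly empty) interval of lower indices $a,\dots,b$, let $$\tau_q^{(r)}(\mathbf x_a,\dots,\mathbf x_b)=\sum x_{i_1}^{(r)}x_{i_2}^{(r-1)}\cdots x_{i_q}^{(r-q+1)},$$ the sum over all $a\le i_1\le\dots\le i_q\le b$ in which no index appears more than $n-1$ times (so $\tau_0^{(r)}=1$). For $a\le b$ let $$\sigma_q^{(r)}(\mathbf x_a,\dots,\mathbf x_b)=\sum_{p=0}^{q}\Big(\prod_{t=0}^{p-1}x_a^{(r-t)}\Big)\tau_{q-p}^{(r-p)}(\mathbf x_{a+1},\dots,\mathbf x_b),$$ $$\bar\sigma_q^{(r)}(\mathbf x_a,\dots,\mathbf x_b)=\sum_{p=0}^{q}\tau_{q-p}^{(r)}(\mathbf x_a,\dots,\mathbf x_{b-1})\prod_{t=0}^{p-1}x_b^{(r-q+p-t)},$$ and for $i\le k<j$ let $$\Omega_k^{(r)}(\mathbf x_i,\dots,\mathbf x_j)=\sum_{\ell=0}^{n-1}\sigma^{(r)}_{(n-1)(k-i)+\ell}(\mathbf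 x_i,\dots,\mathbf x_k)\,\bar\sigma^{(r+k-i-\ell)}_{(n-1)(j-k)-\ell}(\mathbf x_{k+1},\dots,\mathbf x_j).$$ **Theorem.** Let $1\le i<j\le m$, and for $i\le k<j$ let $s=s_ks_{k+1}\cdots s_{j-2}s_{j-1}s_{j-2}\cdots s_{i+1}s_i$. Then, for every $r$ modulo $n$, all denominators below are positive, and: 1. for $i<k<j$, $$\kappa_r\big(s(\mathbf x_{k-1}),s(\mathbf x_k)\big)=\frac{\sigma_{(n-1)(k-i)}^{(r-k+i)}(\mathbf x_i,\dots,\mathbf x_k)\ \Omega_{k-1}^{(r-k+i)}(\mathbf x_i,\dots,\mathbf x_j)}{\sigma_{(n-1)(k-i-1)}^{(r-k+i)}(\mathbf x_i,\dots,\mathbf x_{k-1})\ \Omega_{k}^{(r-k+i)}(\mathbf x_i,\dots,\mathbf x_j)};$$ 2. for $i\le k<j$, $$s(x_k^{(r)})=x_j^{(r+j-k)}\,\frac{\sigma_{(n-1)(k-i)}^{(r-k+i-1)}(\mathbf x_i,\dots,\mathbf x_k)\ \Omega_{k}^{(r-k+i)}(\mathbf x_i,\dots,\mathbf x_j)}{\sigma_{(n-1)(k-i)}^{(r-k+i)}(\mathbf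 x_i,\dots,\mathbf x_k)\ \Omega_{k}^{(r-k+i-1)}(\mathbf x_i,\dots,\mathbf x_j)}.$$ -/

import Mathlib

/-! Upper indices are elements of `ZMod n`. An `m`-tuple of vectors is written as a family
`x : ℕ → ZMod n → ℝ`, of which only the members `x 1, …, x m` matter; `x l r` is the
coordinate with lower index `l` and upper index `r`. -/

namespace BirationalR

open Finset

/-- `κ_r(a, b) = ∑_{s=0}^{n-1} b^{(r+1)} ⋯ b^{(r+s)} a^{(r+s+1)} ⋯ a^{(r+n-1)}`. -/
noncomputable def kappa {n : ℕ} (r : ZMod n) (a b : ZMod n → ℝ) : ℝ :=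
  ∑ s ∈ range n,
    (∏ t ∈ Icc 1 s, b (r + (t : ZMod n))) * ∏ t ∈ Icc (s + 1) (n - 1), a (r + (t : ZMod n))

/-- The birational `R`-matrix `(a, b) ↦ (b', a')`. -/
noncomputable def rMatrix {n : ℕ} (a b : ZMod n → ℝ) : (ZMod n → ℝ) × (ZMod n → ℝ) :=
  (fun r => b (r + 1) * kappa (r + 1) a b / kappa r a b,
   fun r => a (r - 1) * kappa (r - 1) a b / kappa r a b)

/-- The map `η_p`, by which the simple transposition `s_p` acts: it applies the `R`-matrix to the
vectors in positions `p` and `p + 1`. -/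
noncomputable def eta {n : ℕ} (p : ℕ) (x : ℕ → ZMod n → ℝ) : ℕ → ZMod n → ℝ := fun l =>
  if l = p then (rMatrix (x p) (x (p + 1))).1
  else if l = p + 1 then (rMatrix (x p) (x (p + 1))).2
  else x l

/-- The action of a product of simple transpositions: the word `[p₁, …, p_q]` stands for
`s_{p₁} ⋯ s_{p_q}` and acts as `η_{p₁} ∘ ⋯ ∘ η_{p_q}`, the rightmost factor first. -/
noncomputable def act {n : ℕ} (w : List ℕ) (x : ℕ → ZMod n → ℝ) : ℕ → ZMod n → ℝ :=
  w.foldr eta x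

/-- The word of `s_k s_{k+1} ⋯ s_{j-2} s_{j-1} s_{j-2} ⋯ s_{i+1} s_i`, where `i ≤ k < j`. -/
def transWord (i k j : ℕ) : List ℕ :=
  List.range' k (j - k) ++ (List.range' i (j - 1 - i)).reverse

/-- `τ_k^{(r)}` of the vectors `x l`, `l ∈ S`, in increasing order of `l`: the sum of
`x_{f(0)}^{(r)} x_{f(1)}^{(r-1)} ⋯ x_{f(k-1)}^{(r-k+1)}` over all weakly increasing sequences `f`
in `S` in which no index appears more than `n - 1` times. -/
noncomputable def tau {n : ℕ} (k : ℕ) (r : ZMod n) (x : ℕ → ZMod n → ℝ) (S : Finset ℕ) : ℝ :=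
  ∑ f ∈ (Fintype.piFinset fun _ : Fin k => S) with
      (∀ s t : Fin k, s ≤ t → f s ≤ f t) ∧
        ∀ l ∈ S, (univ.filter fun t : Fin k => f t = l).card ≤ n - 1,
    ∏ t : Fin k, x (f t) (r - ((t : ℕ) : ZMod n))

/-- `σ_k^{(r)}(x_a, …, x_b)`, for `a ≤ b`. -/
noncomputable def sigma {n : ℕ} (k : ℕ) (r : ZMod n) (x : ℕ → ZMod n → ℝ) (a b : ℕ) : ℝ :=
  ∑ q ∈ range (k + 1),
    (∏ t ∈ range q, x a (r - (t : ZMod n))) * tau (k - q) (r - (q : ZMod n)) x (Ioc a b)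

/-- `σ̄_k^{(r)}(x_a, …, x_b)`, for `a ≤ b`. -/
noncomputable def sigmaBar {n : ℕ} (k : ℕ) (r : ZMod n) (x : ℕ → ZMod n → ℝ) (a b : ℕ) : ℝ :=
  ∑ q ∈ range (k + 1),
    tau (k - q) r x (Ico a b) *
      ∏ t ∈ range q, x b (r - (k : ZMod n) + (q : ZMod n) - (t : ZMod n))

/-- `Ω_k^{(r)}(x_i, …, x_j)`, for `i ≤ k < j`. -/
noncomputable def Omega {n : ℕ} (k : ℕ) (r : ZMod n) (x : ℕ → ZMod n → ℝ) (i j : ℕ) : ℝ :=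
  ∑ l ∈ range n,
    sigma ((n - 1) * (k - i) + l) r x i k *
      sigmaBar ((n - 1) * (j - k) - l)
        (r + (k : ZMod n) - (i : ZMod n) - (l : ZMod n)) x (k + 1) j

end BirationalR

/-!
Attach to a vector `a` the first order factor `1 - a S` in the ring of skew power series, where the
variable `S` shifts upper indices: `S a = a' S` with `a'(r) = a (r - 1)`. Since `S ^ n` is
central, so is `(a S) ^ n`, which only depends on the product of the coordinates of `a`. Hence the
truncated series `A(a) = ∑_{p < n} (a S) ^ p` is `(1 - a S)⁻¹` up to a central factor, and

* `τ` is the coefficient of the product of the `A(x_l)` (`tau_Ico`);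
* `σ` is the coefficient of the same product with the first factor replaced by `(1 - x_a S)⁻¹`
  (`sigma_eq`), and `σ̄` of the product with the last factor so replaced (`sigmaBar_eq`);
* `κ_r(a, b)` is the coefficient of `S ^ (n - 1)` in `(1 - a S)⁻¹ (1 - b S)⁻¹`, at `r - 1`
  (`kappa_eq`).

The `R`-matrix preserves `(1 - b S) (1 - a S)` and exchanges the total products of the two vectors,
so that it preserves `A(a) A(b)` (`trunc_rMatrix`).

The word `s_{k-1} ⋯ s_i` moves `x_i` to the right past `x_{i+1}, …, x_k`. By induction the moved
vector `c_k` is a shift of `x_i` times a quotient of two neighbouring values of the top coefficient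
`σ_{(n-1)(k-i)}(x_i, …, x_k)` (`act_reverse_range'`): products of consecutive coordinates of such a
vector telescope, and beyond the top degree `σ` is geometric, so that `κ` of the vector and
`x_{k+1}` is a quotient of a `σ` with one more variable by the old one (`kappa_of_ratio_right`).

For `k = i` the vector in position `i` is, in the same way, a shift of `x_j` times a quotient of
values of the top coefficient of `σ̄(x_i, …, x_j)` (`act_transWord_self`). The induction peels the
word `s_i w s_i` with `w` the transposition of `i + 1` and `j`. The first `s_i` turns
`x_i, x_{i+1}` into `y, c`; by induction `w` puts a quotient of values of
`σ̄(c, x_{i+2}, …, x_j)` next to `y`, and `κ` of the two is the quotient of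
`σ̄(y, c, x_{i+2}, …, x_j)` by that value (`kappa_of_ratio_left`). As `σ̄` is built from
`A(y) A(c) = A(x_i) A(x_{i+1})`, the numerator is `σ̄(x_i, …, x_j)`.

In general the word is the transposition of `k` and `j`, preceded by moving `x_i` to position `k`;
and `Ω_k(x_i, …, x_j)` is `σ(x_i, …, x_k)` times `σ̄(c_k, x_{k+1}, …, x_j)` (`Omega_eq`), which
gives the formulas for all `k`.
-/

namespace BirationalR

open Finset

/-! ### Skew power series -/

/-- Skew power series `∑ F_k S^k` in a shift variable `S`, whose coefficients `F_k` are functions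
on `ZMod n`; the variable satisfies `S a = a' S` with `a' r = a (r - 1)`. Coefficients stand on the
left of the powers of `S`, and `F k r` is the value at `r` of the coefficient of `S ^ k`. -/
def SkewSeries (n : ℕ) : Type := ℕ → ZMod n → ℝ

namespace SkewSeries

variable {n : ℕ}

instance : AddCommGroup (SkewSeries n) := inferInstanceAs (AddCommGroup (ℕ → ZMod n → ℝ))

instance : One (SkewSeries n) := ⟨fun k _ => if k = 0 then 1 else 0⟩

/-- Multiplication is convolution, twisted by the shift. -/
noncomputable instance : Mul (SkewSeries n) :=
  ⟨fun F G k r => ∑ p ∈ antidiagonal k, F p.1 r * G p.2 (r - (p.1 : ZMod n))⟩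

@[ext] theorem ext {F G : SkewSeries n} (h : ∀ k r, F k r = G k r) : F = G :=
  funext fun k => funext fun r => h k r

theorem mul_apply (F G : SkewSeries n) (k : ℕ) (r : ZMod n) :
    (F * G) k r = ∑ p ∈ antidiagonal k, F p.1 r * G p.2 (r - (p.1 : ZMod n)) := rfl

theorem one_apply (k : ℕ) (r : ZMod n) : (1 : SkewSeries n) k r = if k = 0 then 1 else 0 := rfl

@[simp] theorem add_apply (F G : SkewSeries n) (k : ℕ) (r : ZMod n) :
    (F + G) k r = F k r + G k r := rfl

@[simp] theorem sub_apply (F G : SkewSeries n) (k : ℕ) (r : ZMod n) :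
    (F - G) k r = F k r - G k r := rfl

@[simp] theorem zero_apply (k : ℕ) (r : ZMod n) : (0 : SkewSeries n) k r = 0 := rfl

theorem sum_apply {ι : Type*} (s : Finset ι) (F : ι → SkewSeries n) (k : ℕ) (r : ZMod n) :
    (∑ i ∈ s, F i) k r = ∑ i ∈ s, F i k r := by
  classical
  induction s using Finset.induction_on with
  | empty => rfl
  | insert a s ha ih => rw [sum_insert ha, sum_insert ha, add_apply, ih]

theorem mul_assoc' (F G H : SkewSeries n) : F * G * H = F * (G * H) := by
  ext k r
  simp only [mul_apply, sum_mul, mul_sum, sum_sigma']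
  refine sum_nbij' (fun ⟨⟨_, q⟩, ⟨u, v⟩⟩ => ⟨(u, v + q), (v, q)⟩)
    (fun ⟨⟨u, _⟩, ⟨v, q⟩⟩ => ⟨(u + v, q), (u, v)⟩) ?_ ?_ ?_ ?_ ?_
  all_goals
    rintro ⟨⟨p, q⟩, ⟨u, v⟩⟩ h
    simp only [mem_sigma, HasAntidiagonal.mem_antidiagonal] at h ⊢
    obtain ⟨h, rfl⟩ := h
    simp [← h, add_assoc, sub_sub, mul_assoc]

noncomputable instance : Ring (SkewSeries n) :=
  { (inferInstance : AddCommGroup (SkewSeries n)) with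
    mul_assoc := mul_assoc'
    one_mul := fun F => by
      ext k r
      rw [mul_apply, sum_eq_single_of_mem (0, k) (by simp)]
      · simp [one_apply]
      · rintro ⟨p, q⟩ h h'
        have : p ≠ 0 := by rintro rfl; simp_all
        simp [one_apply, this]
    mul_one := fun F => by
      ext k r
      rw [mul_apply, sum_eq_single_of_mem (k, 0) (by simp)]
      · simp [one_apply]
      · rintro ⟨p, q⟩ h h'
        have : q ≠ 0 := by rintro rfl; simp_all
        simp [one_apply, this]
    left_distrib := fun F G H => by
      ext k r; simp only [mul_apply, add_apply, mul_add, sum_add_distrib]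
    right_distrib := fun F G H => by
      ext k r; simp only [mul_apply, add_apply, add_mul, sum_add_distrib]
    zero_mul := fun F => by ext k r; simp [mul_apply]
    mul_zero := fun F => by ext k r; simp [mul_apply] }

/-- The monomial `a S`. -/
def monom (a : ZMod n → ℝ) : SkewSeries n := fun k r => if k = 1 then a r else 0

theorem monom_mul_zero (a : ZMod n → ℝ) (F : SkewSeries n) (r : ZMod n) :
    (monom a * F) 0 r = 0 := by
  simp [mul_apply, monom]

theorem monom_mul_succ (a : ZMod n → ℝ) (F : SkewSeries n) (k : ℕ) (r : ZMod n) :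
    (monom a * F) (k + 1) r = a r * F k (r - 1) := by
  rw [mul_apply, sum_eq_single_of_mem (1, k) (by simp [add_comm])]
  · simp [monom]
  · rintro ⟨p, q⟩ h h'
    have : p ≠ 1 := by rintro rfl; simp at h; exact h' (by simp; omega)
    simp [monom, this]

theorem mul_monom_succ (b : ZMod n → ℝ) (F : SkewSeries n) (k : ℕ) (r : ZMod n) :
    (F * monom b) (k + 1) r = F k r * b (r - (k : ZMod n)) := by
  rw [mul_apply, sum_eq_single_of_mem (k, 1) (by simp)]
  · simp [monom]
  · rintro ⟨p, q⟩ h h'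
    have : q ≠ 1 := by rintro rfl; simp at h; exact h' (by simp; omega)
    simp [monom, this]

/-- The geometric series `(1 - a S)⁻¹`, with coefficients `a^{(r)} a^{(r-1)} ⋯ a^{(r-k+1)}`. -/
noncomputable def geom (a : ZMod n → ℝ) : SkewSeries n :=
  fun k r => ∏ t ∈ range k, a (r - (t : ZMod n))

theorem geom_apply (a : ZMod n → ℝ) (k : ℕ) (r : ZMod n) :
    geom a k r = ∏ t ∈ range k, a (r - (t : ZMod n)) := rfl

@[simp] theorem geom_zero (a : ZMod n → ℝ) (r : ZMod n) : geom a 0 r = 1 := rfl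

theorem geom_succ (a : ZMod n → ℝ) (k : ℕ) (r : ZMod n) :
    geom a (k + 1) r = geom a k r * a (r - (k : ZMod n)) := prod_range_succ _ _

theorem geom_succ' (a : ZMod n → ℝ) (k : ℕ) (r : ZMod n) :
    geom a (k + 1) r = a r * geom a k (r - 1) := by
  rw [geom_apply, prod_range_succ', mul_comm, geom_apply]
  simp [sub_sub, add_comm]

theorem geom_eq_one_add_monom_mul (a : ZMod n → ℝ) : geom a = 1 + monom a * geom a := by
  ext k r
  cases k with
  | zero => simp [one_apply, monom_mul_zero]
  | succ k => simp [one_apply, monom_mul_succ, geom_succ']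

theorem geom_eq_one_add_mul_monom (a : ZMod n → ℝ) : geom a = 1 + geom a * monom a := by
  ext k r
  cases k with
  | zero => simp [one_apply, mul_apply, monom]
  | succ k => simp [one_apply, mul_monom_succ, geom_succ]

theorem monom_pow_apply (a : ZMod n → ℝ) (p k : ℕ) (r : ZMod n) :
    (monom a ^ p) k r = if k = p then geom a p r else 0 := by
  induction p generalizing k r with
  | zero => simp [one_apply]
  | succ p ih =>
    rw [pow_succ']
    cases k with
    | zero => simp [monom_mul_zero]
    | succ k => simp [monom_mul_succ, ih, geom_succ']

/-- The truncated geometric series `∑_{p < n} (a S)^p`, which is `(1 - a S)⁻¹` up to the central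
factor `1 - (a S)^n`. -/
noncomputable def trunc (a : ZMod n → ℝ) : SkewSeries n := ∑ p ∈ range n, monom a ^ p

theorem trunc_apply (a : ZMod n → ℝ) (k : ℕ) (r : ZMod n) :
    trunc a k r = if k < n then geom a k r else 0 := by
  simp [trunc, sum_apply, monom_pow_apply]

/-- A product over `n` consecutive upper indices runs once through all residues. -/
theorem geom_period [NeZero n] (a : ZMod n → ℝ) (r : ZMod n) : geom a n r = ∏ u, a u := by
  refine prod_nbij' (fun t => r - (t : ZMod n)) (fun u => (r - u).val) ?_ ?_ ?_ ?_ ?_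
  · simp
  · intro u _; simpa using ZMod.val_lt _
  · intro t ht; simpa using ZMod.val_cast_of_lt (by simpa using ht)
  · intro u _; simp
  · simp

theorem one_sub_monom_mul_left_cancel (a : ZMod n → ℝ) {F G : SkewSeries n}
    (h : (1 - monom a) * F = (1 - monom a) * G) : F = G := by
  rw [sub_mul, sub_mul, one_mul, one_mul] at h
  ext k r
  induction k generalizing r with
  | zero => simpa [monom_mul_zero] using congrFun (congrFun h 0) r
  | succ k ih =>
    have := congrFun (congrFun h (k + 1)) r
    simp only [sub_apply, monom_mul_succ, ih] at this
    linarith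

/-- The `n`-th power of a monomial is central, as `n` shifts are the identity. -/
theorem monom_pow_mul_comm [NeZero n] (a : ZMod n → ℝ) (F : SkewSeries n) :
    monom a ^ n * F = F * monom a ^ n := by
  ext k r
  rw [mul_apply, mul_apply]
  refine sum_nbij' Prod.swap Prod.swap (by simp [add_comm]) (by simp [add_comm]) (by simp)
    (by simp) fun p _ => ?_
  simp only [monom_pow_apply, Prod.fst_swap, Prod.snd_swap]
  split_ifs with h
  · rw [h, geom_period, geom_period, ZMod.natCast_self, sub_zero, mul_comm]
  · simp

theorem one_sub_monom_mul_trunc (a : ZMod n → ℝ) :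
    (1 - monom a) * trunc a = 1 - monom a ^ n := mul_neg_geom_sum _ _

/-- A product of two truncated geometric series depends only on `(1 - b S)(1 - a S)` and on the
total products of the factors. -/
theorem trunc_mul_trunc_eq [NeZero n] {a b a' b' : ZMod n → ℝ}
    (hadd : ∀ r, b' r + a' r = a r + b r)
    (hmul : ∀ r, b' r * a' (r + 1) = a r * b (r + 1))
    (hb : ∏ u, b' u = ∏ u, b u) (ha : ∏ u, a' u = ∏ u, a u) :
    trunc b' * trunc a' = trunc a * trunc b := by
  have hP : (1 - monom a') * (1 - monom b') = (1 - monom b) * (1 - monom a) := by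
    have h1 : monom a' + monom b' = monom b + monom a := by
      ext k r
      have := hadd r
      simp only [add_apply, monom]
      split_ifs <;> linarith
    have h2 : monom a' * monom b' = monom b * monom a := by
      ext k r
      cases k with
      | zero => simp [monom_mul_zero]
      | succ k =>
        have := hmul (r - 1)
        rw [sub_add_cancel] at this
        simp only [monom_mul_succ, monom]
        split_ifs <;> linarith
    calc (1 - monom a') * (1 - monom b') = 1 - (monom a' + monom b') + monom a' * monom b' := by
          noncomm_ring
      _ = (1 - monom b) * (1 - monom a) := by rw [h1, h2]; noncomm_ring
  have key : ∀ u v : ZMod n → ℝ, (1 - monom v) * (1 - monom u) * (trunc u * trunc v)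
      = (1 - monom u ^ n) * (1 - monom v ^ n) := fun u v => by
    have hc : (1 - monom v) * (1 - monom u ^ n) = (1 - monom u ^ n) * (1 - monom v) := by
      simp only [mul_sub, sub_mul, one_mul, mul_one, monom_pow_mul_comm u (monom v)]
      abel
    rw [mul_assoc, ← mul_assoc _ (trunc u), one_sub_monom_mul_trunc, ← mul_assoc, hc, mul_assoc,
      one_sub_monom_mul_trunc]
  have hpow : ∀ u v : ZMod n → ℝ, ∏ i, u i = ∏ i, v i → monom u ^ n = monom v ^ n :=
    fun u v h => by ext k r; simp only [monom_pow_apply, geom_period, h]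
  have h := key b' a'
  rw [hP, hpow _ _ hb, hpow _ _ ha] at h
  refine one_sub_monom_mul_left_cancel a (one_sub_monom_mul_left_cancel b ?_)
  rw [← mul_assoc (1 - monom b), ← mul_assoc (1 - monom b), h, key a b]
  simp only [mul_sub, sub_mul, one_mul, mul_one, monom_pow_mul_comm a (monom b ^ n)]
  abel

/-! ### Degrees and positivity -/

/-- `F` is a polynomial of degree at most `N` in the shift variable. -/
def DegreeLE (F : SkewSeries n) (N : ℕ) : Prop := ∀ k r, N < k → F k r = 0

theorem DegreeLE.mul {F G : SkewSeries n} {N M : ℕ} (hF : DegreeLE F N) (hG : DegreeLE G M) :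
    DegreeLE (F * G) (N + M) := fun k r hk => by
  rw [mul_apply]
  refine sum_eq_zero fun p hp => ?_
  rw [HasAntidiagonal.mem_antidiagonal] at hp
  rcases lt_or_ge N p.1 with h | h
  · rw [hF _ _ h, zero_mul]
  · rw [hG p.2 _ (by omega), mul_zero]

theorem degreeLE_trunc (a : ZMod n → ℝ) : DegreeLE (trunc a) (n - 1) := fun k r hk => by
  rw [trunc_apply, if_neg (by omega)]

/-- All coefficients of `F` are nonnegative, and that of `S ^ N` is positive. -/
def PosAt (F : SkewSeries n) (N : ℕ) : Prop := (∀ k r, 0 ≤ F k r) ∧ ∀ r, 0 < F N r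

theorem PosAt.mul {F G : SkewSeries n} {N M : ℕ} (hF : PosAt F N) (hG : PosAt G M) :
    PosAt (F * G) (N + M) :=
  ⟨fun _ _ => sum_nonneg fun _ _ => mul_nonneg (hF.1 _ _) (hG.1 _ _), fun _ =>
    sum_pos' (fun _ _ => mul_nonneg (hF.1 _ _) (hG.1 _ _))
      ⟨(N, M), by simp, mul_pos (hF.2 _) (hG.2 _)⟩⟩

theorem posAt_one : PosAt (1 : SkewSeries n) 0 :=
  ⟨fun k r => by rw [one_apply]; split_ifs <;> norm_num, fun r => by simp [one_apply]⟩

theorem posAt_geom {a : ZMod n → ℝ} (ha : ∀ r, 0 < a r) (k : ℕ) : PosAt (geom a) k :=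
  have h : ∀ k r, 0 < geom a k r := fun _ _ => prod_pos fun _ _ => ha _
  ⟨fun k r => (h k r).le, h k⟩

theorem posAt_trunc [NeZero n] {a : ZMod n → ℝ} (ha : ∀ r, 0 < a r) :
    PosAt (trunc a) (n - 1) := by
  have hn := NeZero.pos n
  refine ⟨fun k r => ?_, fun r => ?_⟩
  · rw [trunc_apply]
    split_ifs
    · exact (posAt_geom ha 0).1 _ _
    · exact le_rfl
  · rw [trunc_apply, if_pos (by omega)]
    exact (posAt_geom ha _).2 r

/-- A geometric series times a polynomial of degree `N`: beyond degree `N`, coefficients arise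
by multiplication with the ratio. -/
theorem geom_mul_apply_add (a : ZMod n → ℝ) {F : SkewSeries n} {N : ℕ} (hF : DegreeLE F N)
    (p : ℕ) (r : ZMod n) :
    (geom a * F) (N + p) r = geom a p r * (geom a * F) N (r - (p : ZMod n)) := by
  induction p generalizing r with
  | zero => simp
  | succ p ih =>
    have h : geom a * F = F + monom a * (geom a * F) := by
      rw [← mul_assoc]
      conv_lhs => rw [geom_eq_one_add_monom_mul, add_mul, one_mul]
    conv_lhs => rw [h]
    rw [add_apply, ← add_assoc, monom_mul_succ, hF _ _ (by omega), ih, geom_succ']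
    push_cast
    rw [sub_sub, add_comm 1 (p : ZMod n)]
    ring

theorem mul_geom_apply_add (b : ZMod n → ℝ) {F : SkewSeries n} {N : ℕ} (hF : DegreeLE F N)
    (p : ℕ) (r : ZMod n) :
    (F * geom b) (N + p) r = (F * geom b) N r * geom b p (r - (N : ZMod n)) := by
  induction p generalizing r with
  | zero => simp
  | succ p ih =>
    have h : F * geom b = F + F * geom b * monom b := by
      rw [mul_assoc]
      conv_lhs => rw [geom_eq_one_add_mul_monom, mul_add, mul_one]
    conv_lhs => rw [h]
    rw [add_apply, ← add_assoc, mul_monom_succ, hF _ _ (by omega), ih, geom_succ]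
    push_cast
    rw [sub_sub]
    ring

end SkewSeries

/-! ### The series of the functions `τ`, `σ` and `σ̄` -/

open SkewSeries

variable {n : ℕ}

theorem card_filter_fin_add {p q : ℕ} (P : Fin (p + q) → Prop) [DecidablePred P] :
    (univ.filter P).card = (univ.filter fun t : Fin p => P (Fin.castAdd q t)).card +
      (univ.filter fun t : Fin q => P (Fin.natAdd p t)).card := by
  simp only [card_filter, Fin.sum_univ_add]

/-- The last `q` terms of a weakly increasing sequence that takes its greatest possible value `b`
exactly `q` times are equal to `b`. -/
theorem eq_max_of_card_filter_eq {p q b : ℕ} {f : Fin (p + q) → ℕ}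
    (hmono : ∀ s t, s ≤ t → f s ≤ f t) (hb : ∀ t, f t ≤ b)
    (hcard : (univ.filter fun t => f t = b).card = q) (t : Fin q) : f (Fin.natAdd p t) = b := by
  by_contra h
  have hsub : (univ.filter fun t => f t = b) ⊆ Ioi (Fin.natAdd p t) := fun u hu => by
    rw [mem_Ioi]
    by_contra! hut
    have h1 := hmono _ _ hut
    rw [(mem_filter.1 hu).2] at h1
    exact h (le_antisymm (hb _) h1)
  have h2 := card_le_card hsub
  rw [hcard, Fin.card_Ioi, Fin.val_natAdd] at h2
  omega

/-- `τ` of an interval of vectors is obtained by splitting off the factors of the last vector. -/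
theorem tau_insert [NeZero n] (k : ℕ) (r : ZMod n) (x : ℕ → ZMod n → ℝ) {S : Finset ℕ} {b : ℕ}
    (hS : ∀ l ∈ S, l < b) :
    tau k r x (insert b S) =
      ∑ p ∈ antidiagonal k, tau p.1 r x S * trunc (x b) p.2 (r - (p.1 : ZMod n)) := by
  have hn := NeZero.pos n
  have hbS : b ∉ S := fun h => (hS b h).ne rfl
  have hle : ∀ l ∈ insert b S, l ≤ b := fun l hl => by
    rcases mem_insert.1 hl with rfl | hl
    · exact le_rfl
    · exact (hS l hl).le
  have hc : ∀ f : Fin k → ℕ, (univ.filter fun t => f t = b).card ≤ k := fun f => by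
    simpa using card_filter_le univ fun t => f t = b
  rw [tau, ← sum_fiberwise_of_maps_to (t := antidiagonal k)
    (g := fun f : Fin k → ℕ => (k - (univ.filter fun t => f t = b).card,
      (univ.filter fun t => f t = b).card))
    fun f _ => by
      rw [HasAntidiagonal.mem_antidiagonal]
      exact Nat.sub_add_cancel (hc f)]
  -- the sequences in which `b` appears `q` times: for `q < n` they are the sequences in `S`
  -- followed by `q` terms `b`, and otherwise there are none
  refine sum_congr rfl fun pq hpq => ?_
  obtain ⟨p, q⟩ := pq
  rw [HasAntidiagonal.mem_antidiagonal] at hpq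
  dsimp only at hpq ⊢
  subst hpq
  rw [trunc_apply]
  split_ifs with hq
  · rw [tau, sum_mul]
    refine sum_nbij' (fun f t => f (Fin.castAdd q t)) (fun g => Fin.append g fun _ => b)
      ?_ ?_ ?_ ?_ ?_
    · intro f hf
      simp only [mem_filter, Fintype.mem_piFinset, Prod.mk.injEq] at hf ⊢
      obtain ⟨⟨hfS, hmono, hcard⟩, -, hq'⟩ := hf
      have hlast := eq_max_of_card_filter_eq hmono (fun t => hle _ (hfS t)) hq'
      have hfirst : ∀ t : Fin p, f (Fin.castAdd q t) ≠ b := by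
        rw [card_filter_fin_add] at hq'
        simp only [hlast, filter_true, card_univ, Fintype.card_fin] at hq'
        have h0 : (univ.filter fun t : Fin p => f (Fin.castAdd q t) = b).card = 0 := by omega
        rw [card_eq_zero, filter_eq_empty_iff] at h0
        exact fun t => h0 (mem_univ t)
      refine ⟨fun t => (mem_insert.1 (hfS _)).resolve_left (hfirst t),
        fun s t hst => hmono _ _ hst, fun l hl => ?_⟩
      have h1 := hcard l (mem_insert_of_mem hl)
      rw [card_filter_fin_add] at h1
      omega
    · intro g hg
      simp only [mem_filter, Fintype.mem_piFinset, Prod.mk.injEq] at hg ⊢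
      obtain ⟨hgS, hmono, hcard⟩ := hg
      have hgb : ∀ t, g t ≠ b := fun t h => hbS (h ▸ hgS t)
      have hcb : (univ.filter fun t => Fin.append g (fun _ : Fin q => b) t = b).card = q := by
        rw [card_filter_fin_add]
        simp [hgb]
      refine ⟨⟨fun t => ?_, fun s t => ?_, fun l hl => ?_⟩, by omega, hcb⟩
      · refine Fin.addCases (fun t => ?_) (fun t => ?_) t
        · simpa using Or.inr (hgS t)
        · simp
      · refine Fin.addCases (fun s => ?_) (fun s => ?_) s <;>
          refine Fin.addCases (fun t => ?_) (fun t => ?_) t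
        · intro hst
          simpa using hmono s t hst
        · intro _
          simpa using (hS _ (hgS s)).le
        · intro hst
          rw [Fin.le_def, Fin.val_natAdd, Fin.val_castAdd] at hst
          omega
        · simp
      · rcases mem_insert.1 hl with rfl | hl
        · omega
        · rw [card_filter_fin_add]
          have hlb : b ≠ l := (hS l hl).ne'
          simpa [hlb] using hcard l hl
    · intro f hf
      simp only [mem_filter, Fintype.mem_piFinset, Prod.mk.injEq] at hf
      obtain ⟨⟨hfS, hmono, -⟩, -, hq'⟩ := hf
      have hlast := eq_max_of_card_filter_eq hmono (fun t => hle _ (hfS t)) hq'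
      funext t
      refine Fin.addCases (fun t => ?_) (fun t => ?_) t
      · simp
      · simp [hlast]
    · intro g _
      simp
    · intro f hf
      simp only [mem_filter, Fintype.mem_piFinset, Prod.mk.injEq] at hf
      obtain ⟨⟨hfS, hmono, -⟩, -, hq'⟩ := hf
      have hlast := eq_max_of_card_filter_eq hmono (fun t => hle _ (hfS t)) hq'
      rw [Fin.prod_univ_add, geom_apply, ← Fin.prod_univ_eq_prod_range]
      simp [hlast, sub_sub]
  · rw [mul_zero]
    refine sum_eq_zero fun f hf => ?_
    simp only [mem_filter, Prod.mk.injEq] at hf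
    obtain ⟨⟨-, -, hcard⟩, -, hq'⟩ := hf
    have := hcard b (mem_insert_self _ _)
    omega

theorem tau_empty (k : ℕ) (r : ZMod n) (x : ℕ → ZMod n → ℝ) :
    tau k r x ∅ = if k = 0 then 1 else 0 := by
  cases k with
  | zero => simp [tau]
  | succ k => simp [tau]

/-- The ordered product of the truncated geometric series of `x_a, …, x_{a+d-1}`. -/
noncomputable def truncProd (x : ℕ → ZMod n → ℝ) (a : ℕ) : ℕ → SkewSeries n
  | 0 => 1
  | d + 1 => truncProd x a d * trunc (x (a + d))

@[simp] theorem truncProd_zero (x : ℕ → ZMod n → ℝ) (a : ℕ) : truncProd x a 0 = 1 := rfl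

theorem truncProd_succ (x : ℕ → ZMod n → ℝ) (a d : ℕ) :
    truncProd x a (d + 1) = truncProd x a d * trunc (x (a + d)) := rfl

theorem truncProd_succ' (x : ℕ → ZMod n → ℝ) (a d : ℕ) :
    truncProd x a (d + 1) = trunc (x a) * truncProd x (a + 1) d := by
  induction d with
  | zero => simp [truncProd_succ]
  | succ d ih =>
    rw [truncProd_succ, ih, truncProd_succ, mul_assoc, show a + (d + 1) = a + 1 + d by omega]

theorem truncProd_congr {x y : ℕ → ZMod n → ℝ} {a d : ℕ}
    (h : ∀ l, a ≤ l → l < a + d → x l = y l) : truncProd x a d = truncProd y a d := by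
  induction d with
  | zero => rfl
  | succ d ih =>
    rw [truncProd_succ, truncProd_succ, ih fun l h1 h2 => h l h1 (by omega),
      h (a + d) (by omega) (by omega)]

theorem tau_Ico [NeZero n] (k : ℕ) (r : ZMod n) (x : ℕ → ZMod n → ℝ) (a d : ℕ) :
    tau k r x (Ico a (a + d)) = truncProd x a d k r := by
  induction d generalizing k r with
  | zero => rw [add_zero, Ico_self, tau_empty, truncProd_zero, one_apply]
  | succ d ih =>
    have hI : Ico a (a + (d + 1)) = insert (a + d) (Ico a (a + d)) := by
      ext l; simp only [mem_Ico, mem_insert]; omega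
    rw [hI, tau_insert k r x fun l hl => (mem_Ico.1 hl).2, truncProd_succ, mul_apply]
    exact sum_congr rfl fun p _ => by rw [ih]

theorem degreeLE_truncProd (x : ℕ → ZMod n → ℝ) (a d : ℕ) :
    DegreeLE (truncProd x a d) ((n - 1) * d) := by
  induction d with
  | zero => intro k r hk; rw [truncProd_zero, one_apply, if_neg (by omega)]
  | succ d ih => rw [truncProd_succ, mul_add_one]; exact ih.mul (degreeLE_trunc _)

theorem posAt_truncProd [NeZero n] {x : ℕ → ZMod n → ℝ} {a d : ℕ}
    (hx : ∀ l, a ≤ l → l < a + d → ∀ r, 0 < x l r) : PosAt (truncProd x a d) ((n - 1) * d) := by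
  induction d with
  | zero => exact posAt_one
  | succ d ih =>
    rw [truncProd_succ, mul_add_one]
    exact (ih fun l h1 h2 => hx l h1 (by omega)).mul (posAt_trunc (hx _ (by omega) (by omega)))

theorem sigma_eq [NeZero n] (k : ℕ) (r : ZMod n) (x : ℕ → ZMod n → ℝ) (a d : ℕ) :
    sigma k r x a (a + d) = (geom (x a) * truncProd x (a + 1) d) k r := by
  have hI : Ioc a (a + d) = Ico (a + 1) (a + 1 + d) := by
    ext l; simp only [mem_Ioc, mem_Ico]; omega
  rw [sigma, mul_apply, Nat.sum_antidiagonal_eq_sum_range_succ_mk, hI]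
  exact sum_congr rfl fun q _ => by rw [tau_Ico]; rfl

theorem sigmaBar_eq [NeZero n] (k : ℕ) (r : ZMod n) (x : ℕ → ZMod n → ℝ) (a d : ℕ) :
    sigmaBar k r x a (a + d) = (truncProd x a d * geom (x (a + d))) k r := by
  rw [sigmaBar, mul_apply, Nat.sum_antidiagonal_eq_sum_range_succ_mk, ← sum_range_reflect]
  refine sum_congr rfl fun q hq => ?_
  rw [mem_range] at hq
  rw [tau_Ico, geom_apply, show k - (k + 1 - 1 - q) = q by omega,
    show k + 1 - 1 - q = k - q by omega, Nat.cast_sub (by omega)]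
  refine congrArg _ (prod_congr rfl fun t _ => ?_)
  congr 1
  ring

theorem prod_Icc_eq_geom (a : ZMod n → ℝ) (r : ZMod n) (u s : ℕ) :
    ∏ t ∈ Icc (u + 1) (u + s), a (r + (t : ZMod n)) = geom a s (r + ((u + s : ℕ) : ZMod n)) := by
  induction s with
  | zero => simp
  | succ s ih =>
    rw [← add_assoc, prod_Icc_succ_top (by omega), ih, geom_succ', mul_comm]
    push_cast
    congr 2
    ring

/-- The summands of `κ` are the products of a monomial of `(1 - a S)⁻¹` and one of `(1 - b S)⁻¹`
whose degrees add up to `n - 1`, read from the upper index `r + n - 1 = r - 1` downwards. -/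
theorem kappa_eq_sum [NeZero n] (r : ZMod n) (a b : ZMod n → ℝ) :
    kappa r a b = ∑ p ∈ antidiagonal (n - 1),
      geom a p.1 (r - 1) * geom b p.2 (r - 1 - (p.1 : ZMod n)) := by
  have hn := NeZero.pos n
  rw [kappa, Nat.sum_antidiagonal_eq_sum_range_succ_mk, ← sum_range_reflect, Nat.succ_eq_add_one,
    Nat.sub_add_cancel hn]
  refine sum_congr rfl fun s hs => ?_
  rw [mem_range] at hs
  have h1 := prod_Icc_eq_geom b r 0 (n - 1 - s)
  have h2 := prod_Icc_eq_geom a r (n - 1 - s) s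
  rw [zero_add, zero_add] at h1
  rw [show n - 1 - s + s = n - 1 by omega] at h2
  rw [h1, h2, Nat.cast_sub (show s ≤ n - 1 by omega), Nat.cast_sub hn, ZMod.natCast_self,
    Nat.cast_one, mul_comm]
  congr 2 <;> ring

/-! ### The birational `R`-matrix -/

theorem kappa_eq [NeZero n] (r : ZMod n) (a b : ZMod n → ℝ) :
    kappa r a b = (geom a * geom b) (n - 1) (r - 1) := kappa_eq_sum r a b

theorem kappa_pos [NeZero n] {a b : ZMod n → ℝ} (ha : ∀ r, 0 < a r) (hb : ∀ r, 0 < b r)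
    (r : ZMod n) : 0 < kappa r a b := by
  rw [kappa_eq]
  simpa using ((posAt_geom ha 0).mul (posAt_geom hb (n - 1))).2 (r - 1)

/-- Both sides compute the coefficient of `S ^ n` in `(1 - a S)⁻¹ (1 - b S)⁻¹`, by splitting off
the last factor of each monomial on the left and the first one on the right. -/
theorem mul_kappa_succ_add_prod [NeZero n] (a b : ZMod n → ℝ) (r : ZMod n) :
    b (r + 1) * kappa (r + 1) a b + ∏ u, a u = a r * kappa r a b + ∏ u, b u := by
  have hn : n - 1 + 1 = n := Nat.sub_add_cancel (NeZero.pos n)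
  have h1 : geom a * geom b = geom b + monom a * (geom a * geom b) := by
    rw [← mul_assoc]
    conv_lhs => rw [geom_eq_one_add_monom_mul a, add_mul, one_mul]
  have h2 : geom a * geom b = geom a + geom a * geom b * monom b := by
    rw [mul_assoc]
    conv_lhs => rw [geom_eq_one_add_mul_monom b, mul_add, mul_one]
  have h := congrFun (congrFun (h2.symm.trans h1) (n - 1 + 1)) r
  rw [add_apply, add_apply, mul_monom_succ, monom_mul_succ, hn, geom_period, geom_period,
    Nat.cast_sub (NeZero.pos n), ZMod.natCast_self, Nat.cast_one, zero_sub, sub_neg_eq_add,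
    ← kappa_eq] at h
  rw [kappa_eq (r + 1), add_sub_cancel_right]
  linarith

theorem rMatrix_add [NeZero n] {a b : ZMod n → ℝ} (hκ : ∀ r, kappa r a b ≠ 0) (r : ZMod n) :
    (rMatrix a b).1 r + (rMatrix a b).2 r = a r + b r := by
  have h1 := mul_kappa_succ_add_prod a b r
  have h2 := mul_kappa_succ_add_prod a b (r - 1)
  rw [sub_add_cancel] at h2
  have h := hκ r
  simp only [rMatrix]
  field_simp
  linarith

theorem rMatrix_mul {a b : ZMod n → ℝ} (hκ : ∀ r, kappa r a b ≠ 0) (r : ZMod n) :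
    (rMatrix a b).1 r * (rMatrix a b).2 (r + 1) = a r * b (r + 1) := by
  have h1 := hκ r
  have h2 := hκ (r + 1)
  simp only [rMatrix, add_sub_cancel_right]
  field_simp

theorem prod_rMatrix_fst [NeZero n] {a b : ZMod n → ℝ} (hκ : ∀ r, kappa r a b ≠ 0) :
    ∏ u, (rMatrix a b).1 u = ∏ u, b u := by
  have h : ∏ u, b (u + 1) * kappa (u + 1) a b = ∏ u, b u * kappa u a b :=
    Fintype.prod_equiv (Equiv.addRight 1) _ _ fun _ => rfl
  simp only [rMatrix]
  rw [prod_div_distrib, h, prod_mul_distrib, mul_div_cancel_right₀ _ (prod_ne_zero_iff.2 fun u _ => hκ u)]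

theorem prod_rMatrix_snd [NeZero n] {a b : ZMod n → ℝ} (hκ : ∀ r, kappa r a b ≠ 0) :
    ∏ u, (rMatrix a b).2 u = ∏ u, a u := by
  have h : ∏ u, a (u - 1) * kappa (u - 1) a b = ∏ u, a u * kappa u a b :=
    Fintype.prod_equiv (Equiv.subRight 1) _ _ fun _ => rfl
  simp only [rMatrix]
  rw [prod_div_distrib, h, prod_mul_distrib, mul_div_cancel_right₀ _ (prod_ne_zero_iff.2 fun u _ => hκ u)]

/-- The functions `τ` of two vectors are invariant under the `R`-matrix. -/
theorem trunc_rMatrix [NeZero n] {a b : ZMod n → ℝ} (hκ : ∀ r, kappa r a b ≠ 0) :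
    trunc (rMatrix a b).1 * trunc (rMatrix a b).2 = trunc a * trunc b :=
  trunc_mul_trunc_eq (rMatrix_add hκ) (rMatrix_mul hκ) (prod_rMatrix_fst hκ) (prod_rMatrix_snd hκ)

/-! ### Evaluation of `κ` on quotients of shifted functions -/

/-- In degrees at least `n - 1`, the coefficients of a product with a truncated geometric series
are sums of exactly `n` terms. -/
theorem mul_trunc_apply_add [NeZero n] (F : SkewSeries n) (b : ZMod n → ℝ) (N : ℕ) (r : ZMod n) :
    (F * trunc b) (N + (n - 1)) r = ∑ p ∈ antidiagonal (n - 1),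
      F (N + p.1) r * geom b p.2 (r - (N : ZMod n) - (p.1 : ZMod n)) := by
  have hn := NeZero.pos n
  symm
  refine sum_of_injOn (fun p => (N + p.1, p.2)) ?_ ?_ ?_ ?_
  · rintro ⟨p, q⟩ _ ⟨p', q'⟩ _ h
    simpa using h
  · rintro ⟨p, q⟩ h
    simp only [mem_coe, HasAntidiagonal.mem_antidiagonal] at h ⊢
    omega
  · rintro ⟨p, q⟩ h h'
    simp only [HasAntidiagonal.mem_antidiagonal] at h
    rw [trunc_apply, if_neg, mul_zero]
    intro hq
    dsimp only at hq
    refine h' ⟨(p - N, q), ?_, ?_⟩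
    · simp only [mem_coe, HasAntidiagonal.mem_antidiagonal]; omega
    · simp only [Prod.mk.injEq, and_true]; omega
  · rintro ⟨p, q⟩ h
    simp only [HasAntidiagonal.mem_antidiagonal] at h
    rw [trunc_apply, if_pos (by dsimp only; omega)]
    push_cast
    rw [sub_sub]

theorem trunc_mul_apply_add [NeZero n] (a : ZMod n → ℝ) (F : SkewSeries n) (N : ℕ) (r : ZMod n) :
    (trunc a * F) (N + (n - 1)) r = ∑ p ∈ antidiagonal (n - 1),
      geom a p.1 r * F (N + p.2) (r - (p.1 : ZMod n)) := by
  have hn := NeZero.pos n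
  symm
  refine sum_of_injOn (fun p => (p.1, N + p.2)) ?_ ?_ ?_ ?_
  · rintro ⟨p, q⟩ _ ⟨p', q'⟩ _ h
    simpa using h
  · rintro ⟨p, q⟩ h
    simp only [mem_coe, HasAntidiagonal.mem_antidiagonal] at h ⊢
    omega
  · rintro ⟨p, q⟩ h h'
    simp only [HasAntidiagonal.mem_antidiagonal] at h
    rw [trunc_apply, if_neg, zero_mul]
    intro hp
    dsimp only at hp
    refine h' ⟨(p, q - N), ?_, ?_⟩
    · simp only [mem_coe, HasAntidiagonal.mem_antidiagonal]; omega
    · simp only [Prod.mk.injEq, true_and]; omega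
  · rintro ⟨p, q⟩ h
    simp only [HasAntidiagonal.mem_antidiagonal] at h
    rw [trunc_apply, if_pos (by dsimp only; omega)]

/-- Products of consecutive coordinates of a quotient of neighbouring values telescope. -/
theorem geom_of_ratio_right {a c f : ZMod n → ℝ} {e : ZMod n} (hf : ∀ r, f r ≠ 0)
    (hc : ∀ r, c r = a (r - e) * (f (r - e - 1) / f (r - e))) (p : ℕ) (r : ZMod n) :
    geom c p r = geom a p (r - e) * (f (r - e - (p : ZMod n)) / f (r - e)) := by
  induction p with
  | zero => simp [hf]
  | succ p ih =>
    rw [geom_succ, geom_succ, ih, hc]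
    have h1 := hf (r - e)
    have h2 := hf (r - e - p)
    rw [show r - (p : ZMod n) - e = r - e - p by ring,
      show r - e - ((p + 1 : ℕ) : ZMod n) = r - e - p - 1 by push_cast; ring]
    field_simp

theorem geom_of_ratio_left {b d f : ZMod n → ℝ} {e : ZMod n} (hf : ∀ r, f r ≠ 0)
    (hd : ∀ r, d r = b (r + e) * (f r / f (r - 1))) (p : ℕ) (r : ZMod n) :
    geom d p r = geom b p (r + e) * (f r / f (r - (p : ZMod n))) := by
  induction p with
  | zero => simp [hf]
  | succ p ih =>
    rw [geom_succ, geom_succ, ih, hd]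
    have h1 := hf (r - p)
    have h2 := hf (r - p - 1)
    rw [show r - (p : ZMod n) + e = r + e - p by ring,
      show r - ((p + 1 : ℕ) : ZMod n) = r - p - 1 by push_cast; ring]
    field_simp

/-- The value of `κ` when the left vector is a quotient of coefficients `σ` of `(1 - a S)⁻¹ T`:
since these coefficients are geometric beyond degree `N`, the sum defining `κ` becomes the
convolution with one more factor. -/
theorem kappa_of_ratio_right [NeZero n] {a b c : ZMod n → ℝ} {T : SkewSeries n} {N : ℕ}
    {e : ZMod n} (hT : DegreeLE T N) (hne : ∀ r, (geom a * T) N r ≠ 0)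
    (hN : (N : ZMod n) = -e)
    (hc : ∀ r, c r = a (r - e) * ((geom a * T) N (r - e - 1) / (geom a * T) N (r - e)))
    (r : ZMod n) :
    kappa r c b = (geom a * T * trunc b) (N + (n - 1)) (r - 1 - e) /
      (geom a * T) N (r - 1 - e) := by
  rw [eq_div_iff (hne _), kappa_eq_sum, mul_trunc_apply_add, sum_mul]
  refine sum_congr rfl fun p _ => ?_
  have h := hne (r - 1 - e)
  rw [geom_of_ratio_right hne hc, geom_mul_apply_add a hT, hN,
    show r - 1 - e - -e - (p.1 : ZMod n) = r - 1 - p.1 by ring]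
  field_simp

/-- The value of `κ` when the right vector is a quotient of coefficients `σ̄` of `T (1 - b S)⁻¹`. -/
theorem kappa_of_ratio_left [NeZero n] {b d y : ZMod n → ℝ} {T : SkewSeries n} {N : ℕ}
    {e : ZMod n} (hT : DegreeLE T N) (hne : ∀ r, (T * geom b) N r ≠ 0)
    (hN : (N : ZMod n) = -e)
    (hd : ∀ r, d r = b (r + e) * ((T * geom b) N r / (T * geom b) N (r - 1)))
    (r : ZMod n) :
    kappa r y d = (trunc y * (T * geom b)) (N + (n - 1)) (r - 1) / (T * geom b) N r := by
  rw [eq_div_iff (hne _), kappa_eq_sum, trunc_mul_apply_add, sum_mul]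
  refine sum_congr rfl fun p hp => ?_
  -- the shift by `p.1 + p.2 + 1 = n` is trivial
  have hp' : r - 1 - (p.1 : ZMod n) - p.2 = r := by
    have h1 : p.1 + p.2 + 1 = n := by
      rw [HasAntidiagonal.mem_antidiagonal.1 hp, Nat.sub_add_cancel (NeZero.pos n)]
    have h2 := congrArg (Nat.cast : ℕ → ZMod n) h1
    rw [ZMod.natCast_self] at h2
    push_cast at h2
    linear_combination -h2
  have h := hne r
  rw [geom_of_ratio_left hne hd, mul_geom_apply_add b hT, hN, hp', sub_neg_eq_add]
  field_simp

/-! ### The action of words -/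

theorem act_append (v w : List ℕ) (x : ℕ → ZMod n → ℝ) : act (v ++ w) x = act v (act w x) :=
  List.foldr_append

@[simp] theorem act_cons (p : ℕ) (w : List ℕ) (x : ℕ → ZMod n → ℝ) :
    act (p :: w) x = eta p (act w x) := rfl

@[simp] theorem act_nil (x : ℕ → ZMod n → ℝ) : act [] x = x := rfl

theorem eta_self (p : ℕ) (x : ℕ → ZMod n → ℝ) : eta p x p = (rMatrix (x p) (x (p + 1))).1 := by
  simp [eta]

theorem eta_succ (p : ℕ) (x : ℕ → ZMod n → ℝ) :
    eta p x (p + 1) = (rMatrix (x p) (x (p + 1))).2 := by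
  simp [eta]

theorem eta_of_ne {p l : ℕ} (x : ℕ → ZMod n → ℝ) (h1 : l ≠ p) (h2 : l ≠ p + 1) :
    eta p x l = x l := by
  simp [eta, h1, h2]

theorem act_of_forall_ne {w : List ℕ} {l : ℕ} (x : ℕ → ZMod n → ℝ)
    (h : ∀ p ∈ w, l ≠ p ∧ l ≠ p + 1) : act w x l = x l := by
  induction w with
  | nil => rfl
  | cons p w ih =>
    rw [act_cons, eta_of_ne _ (h p (by simp)).1 (h p (by simp)).2,
      ih fun q hq => h q (List.mem_cons_of_mem _ hq)]

/-- The word `s_{i+d} ⋯ s_i`, by which `x_i` moves one place further than by `s_{i+d-1} ⋯ s_i`. -/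
theorem reverse_range'_succ (i d : ℕ) :
    (List.range' i (d + 1)).reverse = (i + d) :: (List.range' i d).reverse := by
  rw [List.range'_1_concat, List.reverse_append]; rfl

theorem transWord_eq_append (i e d : ℕ) :
    transWord i (i + e) (i + e + d + 1) =
      transWord (i + e) (i + e) (i + e + d + 1) ++ (List.range' i e).reverse := by
  rw [transWord, transWord, List.append_assoc, ← List.reverse_append,
    show i + e + d + 1 - 1 - (i + e) = d by omega,
    show i + e + d + 1 - 1 - i = e + d by omega, ← List.range'_append_1]

theorem transWord_self_succ (i d : ℕ) :
    transWord i i (i + d + 2) = i :: (transWord (i + 1) (i + 1) (i + d + 2) ++ [i]) := by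
  rw [transWord, transWord, show i + d + 2 - 1 - i = d + 1 by omega,
    show i + d + 2 - i = d + 1 + 1 by omega, show i + d + 2 - (i + 1) = d + 1 by omega,
    show i + d + 2 - 1 - (i + 1) = d by omega, List.range'_succ (s := i) (n := d + 1),
    List.range'_succ (s := i) (n := d)]
  simp

/-! ### Moving the first vector to the right -/

/-- `σ_{(n-1)d}^{(r)}(x_i, …, x_{i+d})`. -/
noncomputable def topSigma (x : ℕ → ZMod n → ℝ) (i d : ℕ) (r : ZMod n) : ℝ :=
  (geom (x i) * truncProd x (i + 1) d) ((n - 1) * d) r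

/-- `σ̄_{(n-1)d}^{(r)}(x_i, …, x_{i+d})`. -/
noncomputable def topSigmaBar (x : ℕ → ZMod n → ℝ) (i d : ℕ) (r : ZMod n) : ℝ :=
  (truncProd x i d * geom (x (i + d))) ((n - 1) * d) r

theorem topSigma_pos [NeZero n] {x : ℕ → ZMod n → ℝ} {i d : ℕ}
    (hx : ∀ l, i ≤ l → l ≤ i + d → ∀ r, 0 < x l r) (r : ZMod n) : 0 < topSigma x i d r := by
  have h := (posAt_geom (hx i le_rfl (by omega)) 0).mul
    (posAt_truncProd (x := x) (a := i + 1) (d := d) fun l h1 h2 => hx l (by omega) (by omega))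
  rw [zero_add] at h
  exact h.2 r

theorem topSigmaBar_pos [NeZero n] {x : ℕ → ZMod n → ℝ} {i d : ℕ}
    (hx : ∀ l, i ≤ l → l ≤ i + d → ∀ r, 0 < x l r) (r : ZMod n) : 0 < topSigmaBar x i d r :=
  ((posAt_truncProd (x := x) (a := i) (d := d) fun l h1 h2 => hx l h1 h2.le).mul
    (posAt_geom (hx (i + d) (by omega) le_rfl) 0)).2 r

theorem cast_pred_mul [NeZero n] (d : ℕ) : (((n - 1) * d : ℕ) : ZMod n) = -(d : ZMod n) := by
  rw [Nat.cast_mul, Nat.cast_sub (NeZero.pos n), ZMod.natCast_self]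
  simp

theorem act_reverse_range'_of_lt (x : ℕ → ZMod n → ℝ) {i d l : ℕ} (h : i + d < l) :
    act (List.range' i d).reverse x l = x l :=
  act_of_forall_ne x fun p hp => by
    rw [List.mem_reverse, List.mem_range'_1] at hp; omega

/-- The vector `x_i` after it has been moved to the right past `x_{i+1}, …, x_{i+d}`. -/
theorem act_reverse_range' [NeZero n] (x : ℕ → ZMod n → ℝ) (i d : ℕ)
    (hx : ∀ l, i ≤ l → l ≤ i + d → ∀ r, 0 < x l r) (r : ZMod n) :
    act (List.range' i d).reverse x (i + d) r = x i (r - (d : ZMod n)) *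
      (topSigma x i d (r - (d : ZMod n) - 1) / topSigma x i d (r - (d : ZMod n))) := by
  induction d generalizing r with
  | zero => simp [topSigma]
  | succ d ih =>
    have hx' : ∀ l, i ≤ l → l ≤ i + d → ∀ r, 0 < x l r := fun l h1 h2 => hx l h1 (by omega)
    specialize ih hx'
    -- the factor `κ` by which the next step multiplies turns `σ` into `σ` of one more vector
    have hσ := fun r => (topSigma_pos hx' r).ne'
    have hσ' := fun r => (topSigma_pos hx r).ne'
    have hκ : ∀ r, kappa r (act (List.range' i d).reverse x (i + d)) (x (i + d + 1)) =
        topSigma x i (d + 1) (r - 1 - d) / topSigma x i d (r - 1 - d) := fun r => by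
      rw [kappa_of_ratio_right (degreeLE_truncProd x (i + 1) d) hσ (cast_pred_mul d) ih, topSigma,
        topSigma, truncProd_succ, mul_add_one, mul_assoc, show i + 1 + d = i + d + 1 by omega]
    rw [reverse_range'_succ, act_cons, ← add_assoc, eta_succ,
      act_reverse_range'_of_lt x (Nat.lt_succ_self _)]
    simp only [rMatrix, hκ, ih]
    have h1 := hσ (r - 1 - d)
    have h2 := hσ (r - 1 - d - 1)
    have h3 := hσ' (r - 1 - d)
    rw [show r - ((d + 1 : ℕ) : ZMod n) = r - 1 - d by push_cast; ring,
      show r - 1 - 1 - (d : ZMod n) = r - 1 - d - 1 by ring]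
    field_simp

/-- Moving `x_i` to position `i + d` keeps the vectors from that position on positive. -/
theorem act_reverse_range'_pos [NeZero n] {x : ℕ → ZMod n → ℝ} {i d m : ℕ}
    (hx : ∀ l, i ≤ l → l ≤ i + d + m → ∀ r, 0 < x l r) :
    ∀ l, i + d ≤ l → l ≤ i + d + m → ∀ r, 0 < act (List.range' i d).reverse x l r := by
  intro l h1 h2 r
  rcases h1.eq_or_lt with rfl | h1
  · have hx' : ∀ l, i ≤ l → l ≤ i + d → ∀ r, 0 < x l r := fun l h1 h2 => hx l h1 (by omega)
    rw [act_reverse_range' x i d hx']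
    exact mul_pos (hx _ le_rfl (by omega) _) (div_pos (topSigma_pos hx' _) (topSigma_pos hx' _))
  · rw [act_reverse_range'_of_lt x h1]
    exact hx l (by omega) h2 r

/-! ### Moving the last vector to the left -/

/-- `σ̄` is invariant under the `R`-matrix acting on the first two of at least three vectors. -/
theorem trunc_mul_topSigmaBar_eta [NeZero n] {x : ℕ → ZMod n → ℝ} {i d : ℕ}
    (hκ : ∀ r, kappa r (x i) (x (i + 1)) ≠ 0) (r : ZMod n) :
    (trunc (eta i x i) * (truncProd (eta i x) (i + 1) (d + 1) *
      geom (eta i x (i + 1 + (d + 1))))) ((n - 1) * (d + 1) + (n - 1)) r =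
      topSigmaBar x i (d + 2) r := by
  have h : trunc (eta i x i) * truncProd (eta i x) (i + 1) (d + 1) = truncProd x i (d + 2) := by
    rw [truncProd_succ', ← mul_assoc, eta_self, eta_succ, trunc_rMatrix hκ, truncProd_succ',
      truncProd_succ', ← mul_assoc]
    congr 1
    exact truncProd_congr fun l h1 _ => eta_of_ne x (by omega) (by omega)
  rw [← mul_assoc, h, eta_of_ne x (by omega) (by omega), topSigmaBar,
    show (n - 1) * (d + 2) = (n - 1) * (d + 1) + (n - 1) from mul_add_one _ _,
    show i + 1 + (d + 1) = i + (d + 2) by omega]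

/-- If the formula for the leftmost vector holds for the intervals of length one less, it gives the
value of `κ` in the last step of moving the last vector to the left. -/
theorem kappa_act_transWord_of [NeZero n] {x : ℕ → ZMod n → ℝ} {i d : ℕ}
    (hx : ∀ l, i ≤ l → l ≤ i + d + 2 → ∀ r, 0 < x l r)
    (h : ∀ r, act (transWord (i + 1) (i + 1) (i + 1 + d + 1)) (eta i x) (i + 1) r =
      eta i x (i + 1 + d + 1) (r + ((d + 1 : ℕ) : ZMod n)) *
        (topSigmaBar (eta i x) (i + 1) (d + 1) r / topSigmaBar (eta i x) (i + 1) (d + 1) (r - 1)))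
    (r : ZMod n) :
    kappa r (act (transWord (i + 1) (i + 1) (i + d + 2) ++ [i]) x i)
        (act (transWord (i + 1) (i + 1) (i + d + 2) ++ [i]) x (i + 1)) =
      topSigmaBar x i (d + 2) (r - 1) / topSigmaBar (eta i x) (i + 1) (d + 1) r := by
  have hκ : ∀ r, kappa r (x i) (x (i + 1)) ≠ 0 := fun r =>
    (kappa_pos (hx i le_rfl (by omega)) (hx (i + 1) (by omega) (by omega)) r).ne'
  have hpos : ∀ l, i + 1 ≤ l → l ≤ i + 1 + (d + 1) → ∀ r, 0 < eta i x l r :=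
    act_reverse_range'_pos (m := d + 1) fun l h1 h2 => hx l h1 (by omega)
  have hfix : act (transWord (i + 1) (i + 1) (i + d + 2)) (eta i x) i = eta i x i :=
    act_of_forall_ne _ fun p hp => by
      simp only [transWord, List.mem_append, List.mem_reverse, List.mem_range'_1] at hp; omega
  rw [act_append, act_cons, act_nil, hfix, show i + d + 2 = i + 1 + d + 1 by omega,
    kappa_of_ratio_left (degreeLE_truncProd (eta i x) (i + 1) (d + 1))
      (fun r => (topSigmaBar_pos hpos r).ne') (cast_pred_mul (d + 1))
      h,
    trunc_mul_topSigmaBar_eta hκ]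
  rfl

/-- The vector in position `i` after the transposition of `i` and `i + d + 1`. -/
theorem act_transWord_self [NeZero n] (x : ℕ → ZMod n → ℝ) (i d : ℕ)
    (hx : ∀ l, i ≤ l → l ≤ i + d + 1 → ∀ r, 0 < x l r) (r : ZMod n) :
    act (transWord i i (i + d + 1)) x i r = x (i + d + 1) (r + ((d + 1 : ℕ) : ZMod n)) *
      (topSigmaBar x i (d + 1) r / topSigmaBar x i (d + 1) (r - 1)) := by
  induction d generalizing i x r with
  | zero =>
    -- for two vectors the formula is the definition of the `R`-matrix
    have h : ∀ r, topSigmaBar x i 1 r = kappa (r + 1) (x i) (x (i + 1)) := fun r => by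
      have := trunc_mul_apply_add (x i) (geom (x (i + 1))) 0 r
      simp only [zero_add] at this
      rw [kappa_eq_sum, topSigmaBar, truncProd_succ, truncProd_zero, one_mul, mul_one, add_zero,
        this, add_sub_cancel_right]
    have hw : transWord i i (i + 0 + 1) = [i] := by simp [transWord]
    rw [hw, act_cons, act_nil, eta_self, h, h]
    simp [rMatrix, mul_div_assoc]
  | succ d ih =>
    have hpos : ∀ l, i + 1 ≤ l → l ≤ i + 1 + d + 1 → ∀ r, 0 < eta i x l r :=
      act_reverse_range'_pos (m := d + 1) fun l h1 h2 => hx l h1 (by omega)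
    have h := ih (eta i x) (i + 1) hpos
    have hκ := kappa_act_transWord_of hx h
    have hw : transWord i i (i + (d + 1) + 1) =
      i :: (transWord (i + 1) (i + 1) (i + d + 2) ++ [i]) := transWord_self_succ i d
    rw [hw, act_cons, eta_self]
    simp only [rMatrix, hκ]
    rw [act_append, act_cons, act_nil, show i + d + 2 = i + 1 + d + 1 by omega, h,
      eta_of_ne x (by omega) (by omega), add_sub_cancel_right]
    have h1 := (topSigmaBar_pos (d := d + 1) hpos r).ne'
    have h2 := (topSigmaBar_pos (d := d + 1) hpos (r + 1)).ne'
    have h3 := (topSigmaBar_pos (d := d + 1 + 1) hx (r - 1)).ne'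
    rw [show r + 1 + ((d + 1 : ℕ) : ZMod n) = r + ((d + 1 + 1 : ℕ) : ZMod n) by push_cast; ring,
      show i + 1 + d + 1 = i + (d + 1) + 1 by omega]
    field_simp

theorem kappa_act_transWord [NeZero n] {x : ℕ → ZMod n → ℝ} {i d : ℕ}
    (hx : ∀ l, i ≤ l → l ≤ i + d + 2 → ∀ r, 0 < x l r) (r : ZMod n) :
    kappa r (act (transWord (i + 1) (i + 1) (i + d + 2) ++ [i]) x i)
        (act (transWord (i + 1) (i + 1) (i + d + 2) ++ [i]) x (i + 1)) =
      topSigmaBar x i (d + 2) (r - 1) / topSigmaBar (eta i x) (i + 1) (d + 1) r :=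
  kappa_act_transWord_of hx (act_transWord_self (eta i x) (i + 1) d
    (act_reverse_range'_pos (m := d + 1) fun l h1 h2 => hx l h1 (by omega))) r

/-! ### The functions `Ω` -/

theorem sigma_eq_topSigma [NeZero n] (x : ℕ → ZMod n → ℝ) (i d : ℕ) (r : ZMod n) :
    sigma ((n - 1) * d) r x i (i + d) = topSigma x i d r := sigma_eq _ _ _ _ _

/-- Up to a factor `σ`, the function `Ω` is `σ̄` of the vectors from position `i + e` on, once `x_i`
has been moved to that position. -/
theorem Omega_eq [NeZero n] (x : ℕ → ZMod n → ℝ) (i e d : ℕ)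
    (hx : ∀ l, i ≤ l → l ≤ i + e → ∀ r, 0 < x l r) (r : ZMod n) :
    Omega (i + e) r x i (i + e + d + 1) = topSigma x i e r *
      topSigmaBar (act (List.range' i e).reverse x) (i + e) (d + 1) (r + (e : ZMod n)) := by
  have hn := NeZero.pos n
  have hσ := fun r => (topSigma_pos hx r).ne'
  have htail : truncProd (act (List.range' i e).reverse x) (i + e + 1) d =
      truncProd x (i + e + 1) d :=
    truncProd_congr fun l h1 _ => act_reverse_range'_of_lt x (by omega)
  rw [topSigmaBar, truncProd_succ', htail, mul_assoc,
    act_reverse_range'_of_lt x (l := i + e + (d + 1)) (by omega),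
    mul_add_one (n - 1) d, trunc_mul_apply_add, Nat.sum_antidiagonal_eq_sum_range_succ_mk, mul_sum,
    Omega, Nat.succ_eq_add_one, Nat.sub_add_cancel hn]
  refine sum_congr rfl fun l hl => ?_
  rw [mem_range] at hl
  rw [geom_of_ratio_right hσ (act_reverse_range' x i e hx),
    show i + e + d + 1 = i + e + 1 + d by omega, sigma_eq, sigmaBar_eq,
    show i + e - i = e by omega, geom_mul_apply_add _ (degreeLE_truncProd _ _ _),
    show (n - 1) * (i + e + 1 + d - (i + e)) - l = (n - 1) * d + (n - 1 - l) by
      rw [show i + e + 1 + d - (i + e) = d + 1 by omega, mul_add_one]; omega,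
    show r + ((i + e : ℕ) : ZMod n) - i - l = r + e - l by push_cast; ring,
    show i + e + (d + 1) = i + e + 1 + d by omega]
  have h := hσ r
  rw [add_sub_cancel_right]
  simp only [topSigma] at h ⊢
  field_simp

end BirationalR

theorem mainTheorem1 (n m : ℕ) (hn : 1 ≤ n) (x : ℕ → ZMod n → ℝ)
    (hx : ∀ l, 1 ≤ l → l ≤ m → ∀ r, 0 < x l r)
    (i j : ℕ) (hi : 1 ≤ i) (hij : i < j) (hj : j ≤ m) :
    (∀ k : ℕ, i < k → k < j → ∀ r : ZMod n,
      0 < BirationalR.sigma ((n - 1) * (k - i - 1)) (r - (k : ZMod n) + (i : ZMod n)) x i (k - 1) *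
          BirationalR.Omega k (r - (k : ZMod n) + (i : ZMod n)) x i j ∧
      BirationalR.kappa r
          (BirationalR.act (BirationalR.transWord i k j) x (k - 1))
          (BirationalR.act (BirationalR.transWord i k j) x k) =
        (BirationalR.sigma ((n - 1) * (k - i)) (r - (k : ZMod n) + (i : ZMod n)) x i k *
          BirationalR.Omega (k - 1) (r - (k : ZMod n) + (i : ZMod n)) x i j) /
        (BirationalR.sigma ((n - 1) * (k - i - 1)) (r - (k : ZMod n) + (i : ZMod n)) x i (k - 1) *
          BirationalR.Omega k (r - (k : ZMod n) + (i : ZMod n)) x i j)) ∧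
    (∀ k : ℕ, i ≤ k → k < j → ∀ r : ZMod n,
      0 < BirationalR.sigma ((n - 1) * (k - i)) (r - (k : ZMod n) + (i : ZMod n)) x i k *
          BirationalR.Omega k (r - (k : ZMod n) + (i : ZMod n) - 1) x i j ∧
      BirationalR.act (BirationalR.transWord i k j) x k r =
        x j (r + (j : ZMod n) - (k : ZMod n)) *
          ((BirationalR.sigma ((n - 1) * (k - i)) (r - (k : ZMod n) + (i : ZMod n) - 1) x i k *
            BirationalR.Omega k (r - (k : ZMod n) + (i : ZMod n)) x i j) /
          (BirationalR.sigma ((n - 1) * (k - i)) (r - (k : ZMod n) + (i : ZMod n)) x i k *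
            BirationalR.Omega k (r - (k : ZMod n) + (i : ZMod n) - 1) x i j))) := by
  open BirationalR in
  have : NeZero n := ⟨by omega⟩
  refine ⟨fun k hik hkj r => ?_, fun k hik hkj r => ?_⟩
  · -- `x_i` is moved to position `k - 1`, and `κ` is that of the last step of the transposition
    -- of `k - 1` and `j`
    obtain ⟨e, rfl⟩ := Nat.exists_eq_add_of_lt hik
    obtain ⟨d, rfl⟩ := Nat.exists_eq_add_of_lt hkj
    have hx' : ∀ l, i ≤ l → l ≤ i + e + (d + 2) → ∀ r, 0 < x l r :=
      fun l h1 h2 => hx l (by omega) (by omega)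
    have hx1 : ∀ l, i ≤ l → l ≤ i + e → ∀ r, 0 < x l r := fun l h1 h2 => hx' l h1 (by omega)
    have hx2 : ∀ l, i ≤ l → l ≤ i + (e + 1) → ∀ r, 0 < x l r := fun l h1 h2 => hx' l h1 (by omega)
    have hy := act_reverse_range'_pos hx'
    have hz := act_reverse_range'_pos (x := x) (i := i) (d := e + 1) (m := d + 1) fun l h1 h2 =>
      hx' l h1 (by omega)
    have hw : transWord i (i + e + 1) (i + e + 1 + d + 1) =
        transWord (i + e + 1) (i + e + 1) (i + e + d + 2) ++ [i + e] ++
          (List.range' i e).reverse := by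
      have := transWord_eq_append i (e + 1) d
      rw [reverse_range'_succ, ← add_assoc] at this
      rw [this, List.append_assoc, show i + e + 1 + d + 1 = i + e + d + 2 by omega]
      rfl
    have hr : r - ((i + e + 1 : ℕ) : ZMod n) + i = r - 1 - e := by push_cast; ring
    have hΩ := Omega_eq x i (e + 1) d hx2 (r - 1 - e)
    rw [show r - 1 - e + ((e + 1 : ℕ) : ZMod n) = r by push_cast; ring] at hΩ
    have hΩ' := Omega_eq x i e (d + 1) hx1 (r - 1 - e)
    rw [sub_add_cancel] at hΩ'
    rw [hr, hw, act_append, show i + e + 1 - 1 = i + e by omega, kappa_act_transWord hy,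
      show i + e + 1 - i = e + 1 by omega, Nat.add_sub_cancel, sigma_eq_topSigma, add_assoc i e 1,
      sigma_eq_topSigma, hΩ, show i + (e + 1) + d + 1 = i + e + (d + 1) + 1 by omega, hΩ']
    have h1 := topSigma_pos hx1 (r - 1 - e)
    have h2 := topSigma_pos hx2 (r - 1 - e)
    have h3 := topSigmaBar_pos hz r
    refine ⟨by positivity, ?_⟩
    rw [reverse_range'_succ, act_cons] at h3 ⊢
    field_simp
  · obtain ⟨e, rfl⟩ := Nat.exists_eq_add_of_le hik
    obtain ⟨d, rfl⟩ := Nat.exists_eq_add_of_lt hkj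
    have hx' : ∀ l, i ≤ l → l ≤ i + e + (d + 1) → ∀ r, 0 < x l r :=
      fun l h1 h2 => hx l (by omega) (by omega)
    have hx1 : ∀ l, i ≤ l → l ≤ i + e → ∀ r, 0 < x l r := fun l h1 h2 => hx' l h1 (by omega)
    have hy := act_reverse_range'_pos hx'
    have hr : r - ((i + e : ℕ) : ZMod n) + i = r - e := by push_cast; ring
    rw [hr, transWord_eq_append, act_append, act_transWord_self _ _ _ hy, Omega_eq x i e d hx1,
      Omega_eq x i e d hx1, show i + e - i = e by omega, sigma_eq_topSigma, sigma_eq_topSigma,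
      sub_add_cancel, show r - e - 1 + (e : ZMod n) = r - 1 by ring,
      act_reverse_range'_of_lt x (by omega),
      show r + ((i + e + d + 1 : ℕ) : ZMod n) - ((i + e : ℕ) : ZMod n) =
        r + ((d + 1 : ℕ) : ZMod n) by push_cast; ring]
    have h1 := topSigma_pos hx1 (r - e)
    have h2 := topSigma_pos hx1 (r - e - 1)
    have h3 := topSigmaBar_pos hy (r - 1)
    refine ⟨by positivity, ?_⟩
    field_simp
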